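/- Let $\mathcal P=(\mathcal P,d,\mu)$ be a metric space with a Borel regular measure $\mu$ such that every ball has finite positive measure and $\mu$ is doubling: there is $c_{\mathrm{dbl}}\ge 1$ with $\mu(B(x,2r))\le c_{\mathrm{dbl}}\,\mu(B(x,r))$ for all $x\in\mathcal P$, $r>0$. Balls are open, and $\lambda B=B(x,\lambda r)$ for $B=B(x,r)$. Let $\mathcal M$ be the set of all $\mu$-measurable functions $\mathcal P\to[-\infty,\infty]$. A Borel function $g:\mathcal P\to[0,\infty]$ is an upper gradient of $u:\mathcal P\to[-\infty,\infty]$ if $|u(\gamma(0))-u(\gamma(l))|\le\int_0^{l} g(\gamma(t))\,dt$ for every non-constant rectifiable curve $\gamma:[0,l]\to\mathcal P$ parametrized by arc length, where $|(\pm\infty)-(\pm\infty)|=\infty$. Let $p\in[1,\infty)$ and assume that $\mathcal P$ supports a $p$-Poincaré inequality: there are $c>0$ and $\lambda\ge1$ such that for all balls $B$, all $u\in\mathcal M$ that are integrable on every ball, and all upper gradients $g$ of $u$, $$\frac1{\mu(B)}\int_B|u-u_B|\,d\mu\le c\,\operatorname{diam}(B)\Bigl(\frac1{\mu(\lambda B)}\int_{\lambda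 B}g^p\,d\mu\Bigr)^{1/p},\qquad u_B=\frac1{\mu(B)}\int_B u\,d\mu .$$ Let $X=\{u\in\mathcal M:\|u\|_X<\infty\}$ be a quasi-Banach function lattice, i.e. $\|\cdot\|_X:\mathcal M\to[0,\infty]$ satisfies, for some constant $C\ge1$ and all $u,v,u_n\in\mathcal M$, $a\in\mathbb R$: $\|u\|_X=0$ if and only if $u=0$ a.e.; $\|au\|_X=|a|\|u\|_X$; $\|u+v\|_X\le C(\|u\|_X+\|v\|_X)$; $\|u\|_X\le\|v\|_X$ whenever $|u|\le|v|$ a.e.; $\bigl\|\sum_{n=1}^\infty u_n\bigr\|_X\le\sum_{n=1}^\infty C^n\|u_n\|_X$ whenever $u_n\ge0$ a.e. for all $n$; and $\|u_n\|_X\to\|u\|_X$ whenever $\|u_n-u\|_X\to0$. Assume that the quasi-norm is absolutely continuous: for every $u\in X$, $\|u\chi_{E_n}\|_X\to0$ for every decreasing sequence of measurable sets $E_n$ with $\mu\bigl(\bigcap_n E_n\bigr)=0$. Let $M_pv(x)=\sup_{B\ni x}\bigl(\frac1{\mu(B)}\int_B|v|^p\,d\mu\bigr)^{1/p}$, the supremum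 being over all balls $B$ that contain $x$, and assume that $$\bigl\|\sigma\,\chi_{\{x\in\mathcal P:\,M_pv(x)>\sigma\}}\bigr\|_X\to0\quad\text{as }\sigma\to\infty,\qquad\text{for every }v\in X.$$ For $u\in\mathcal M$ let $\|u\|_{N^1X}=\|u\|_X+\inf_g\|g\|_X$, the infimum being over all upper gradients $g$ of $u$, and let $N^1X=\{u\in\mathcal M:\|u\|_{N^1X}<\infty\}$. Then Lipschitz functions are dense in $N^1X$: for every $u\in N^1X$ and $\varepsilon>0$ there is a Lipschitz function $f:\mathcal P\to\mathbb R$ with $f\in N^1X$ and $\|u-f\|_{N^1X}<\varepsilon$. -/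

import Mathlib

open MeasureTheory Filter Topology
open scoped ENNReal NNReal

noncomputable section

/-- A quasi-Banach function lattice `X` over `(P, μ)`, given by its quasi-norm, a `[0, ∞]`-valued
functional on the extended real-valued `μ`-measurable functions (for a measure on the Borel
`σ`-algebra, being measurable with respect to the completion of `μ` is `AEMeasurable`). The values of
`qnorm` on other functions are irrelevant. The space itself is the set of measurable functions with
finite quasi-norm, see `QuasiBanachFunctionLattice.Mem`. -/
structure QuasiBanachFunctionLattice {P : Type*} [MeasurableSpace P] (μ : Measure P) where
  /-- the quasi-norm -/
  qnorm : (P → EReal) → ℝ≥0∞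
  /-- the modulus of concavity -/
  modulus : ℝ≥0
  one_le_modulus : 1 ≤ modulus
  qnorm_eq_zero_iff : ∀ u : P → EReal, AEMeasurable u μ → (qnorm u = 0 ↔ u =ᵐ[μ] 0)
  qnorm_smul : ∀ (a : ℝ) (u : P → EReal), AEMeasurable u μ →
    qnorm (fun x => (a : EReal) * u x) = ENNReal.ofReal |a| * qnorm u
  qnorm_add_le : ∀ u v : P → EReal, AEMeasurable u μ → AEMeasurable v μ →
    qnorm (fun x => u x + v x) ≤ modulus * (qnorm u + qnorm v)
  /-- lattice property -/
  qnorm_mono : ∀ u v : P → EReal, AEMeasurable u μ → AEMeasurable v μ →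
    (∀ᵐ x ∂μ, (u x).abs ≤ (v x).abs) → qnorm u ≤ qnorm v
  /-- Riesz--Fischer property; the sequence is indexed from `0`, so that the `n`-th weight is
  `modulus ^ (n + 1)` -/
  qnorm_tsum_le : ∀ u : ℕ → P → ℝ≥0∞, (∀ n, AEMeasurable (u n) μ) →
    qnorm (fun x => ((∑' n, u n x : ℝ≥0∞) : EReal)) ≤
      ∑' n, (modulus : ℝ≥0∞) ^ (n + 1) * qnorm (fun x => (u n x : EReal))
  /-- continuity of the quasi-norm -/
  qnorm_continuous : ∀ (u : ℕ → P → EReal) (v : P → EReal), (∀ n, AEMeasurable (u n) μ) →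
    AEMeasurable v μ → Tendsto (fun n => qnorm (fun x => u n x - v x)) atTop (𝓝 0) →
    Tendsto (fun n => qnorm (u n)) atTop (𝓝 (qnorm v))

namespace QuasiBanachFunctionLattice

variable {P : Type*} [MeasurableSpace P] {μ : Measure P}

/-- Membership of an (everywhere defined) function in the space `X`. -/
def Mem (X : QuasiBanachFunctionLattice μ) (u : P → EReal) : Prop :=
  AEMeasurable u μ ∧ X.qnorm u < ∞

/-- Absolute continuity of the quasi-norm of `X`. -/
def AbsolutelyContinuous (X : QuasiBanachFunctionLattice μ) : Prop :=
  ∀ u : P → EReal, X.Mem u → ∀ E : ℕ → Set P, (∀ n, NullMeasurableSet (E n) μ) → Antitone E →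
    μ (⋂ n, E n) = 0 → Tendsto (fun n => X.qnorm ((E n).indicator u)) atTop (𝓝 0)

end QuasiBanachFunctionLattice

/-- `μ` is doubling, and all balls have positive and finite measure. -/
structure IsDoublingMetricMeasure {P : Type*} [MetricSpace P] [MeasurableSpace P]
    (μ : Measure P) : Prop where
  ball_pos : ∀ (x : P) (r : ℝ), 0 < r → 0 < μ (Metric.ball x r)
  ball_lt_top : ∀ (x : P) (r : ℝ), 0 < r → μ (Metric.ball x r) < ∞
  doubling : ∃ c : ℝ≥0, ∀ (x : P) (r : ℝ), 0 < r →
    μ (Metric.ball x (2 * r)) ≤ c * μ (Metric.ball x r)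

/-- `g` is an upper gradient of `u`. Curves are non-constant, rectifiable and parametrized by
arc length, that is, they are the maps `γ : [0, l] → P` of unit speed with `l > 0`.
In `EReal`, `⊤ - ⊤ = ⊥ - ⊥ = ⊥`, so `|(±∞) - (±∞)| = ∞`. -/
def IsUpperGradient {P : Type*} [MetricSpace P] [MeasurableSpace P]
    (g : P → ℝ≥0∞) (u : P → EReal) : Prop :=
  Measurable g ∧ ∀ (l : ℝ) (γ : ℝ → P), 0 < l → HasUnitSpeedOn γ (Set.Icc 0 l) →
    (u (γ 0) - u (γ l)).abs ≤ ∫⁻ t in Set.Icc 0 l, g (γ t)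

/-- `u` is measurable and integrable on every ball. -/
def IsLocallyIntegrable {P : Type*} [MetricSpace P] [MeasurableSpace P]
    (μ : Measure P) (u : P → EReal) : Prop :=
  AEMeasurable u μ ∧ ∀ (x : P) (r : ℝ), 0 < r → ∫⁻ z in Metric.ball x r, (u z).abs ∂μ < ∞

/-- `(P, μ)` supports a `p`-Poincaré inequality (with dilation factor `lam`). -/
def SupportsPoincare {P : Type*} [MetricSpace P] [MeasurableSpace P]
    (μ : Measure P) (p : ℝ) : Prop :=
  ∃ c : ℝ≥0, 0 < c ∧ ∃ lam : ℝ, 1 ≤ lam ∧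
    ∀ (x : P) (r : ℝ), 0 < r → ∀ u : P → EReal, IsLocallyIntegrable μ u →
      ∀ g : P → ℝ≥0∞, IsUpperGradient g u →
        ⨍⁻ z in Metric.ball x r,
            (u z - ((⨍ y in Metric.ball x r, (u y).toReal ∂μ : ℝ) : EReal)).abs ∂μ ≤
          c * Metric.ediam (Metric.ball x r) *
            (⨍⁻ z in Metric.ball x (lam * r), g z ^ p ∂μ) ^ (1 / p)

/-- The non-centered maximal function `M_p u`, the supremum being over all open balls that
contain `x`. -/
def maximalFunction {P : Type*} [MetricSpace P] [MeasurableSpace P]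
    (μ : Measure P) (p : ℝ) (u : P → EReal) (x : P) : ℝ≥0∞ :=
  ⨆ (y : P) (r : ℝ) (_ : 0 < r) (_ : x ∈ Metric.ball y r),
    (⨍⁻ z in Metric.ball y r, (u z).abs ^ p ∂μ) ^ (1 / p)

namespace QuasiBanachFunctionLattice

variable {P : Type*} [MetricSpace P] [MeasurableSpace P] {μ : Measure P}

/-- The Newtonian quasi-seminorm `‖u‖_X + inf_g ‖g‖_X`, the infimum being over all upper gradients
`g` of `u`. -/
def newtonNorm (X : QuasiBanachFunctionLattice μ) (u : P → EReal) : ℝ≥0∞ :=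
  X.qnorm u + ⨅ (g : P → ℝ≥0∞) (_ : IsUpperGradient g u), X.qnorm (fun x => (g x : EReal))

/-- Membership in the Newtonian space `N¹X`. -/
def MemNewton (X : QuasiBanachFunctionLattice μ) (u : P → EReal) : Prop :=
  AEMeasurable u μ ∧ X.newtonNorm u < ∞

end QuasiBanachFunctionLattice

end

/-!
Given `u ∈ N¹X` with an upper gradient `g ∈ X`, absolute continuity of the quasi-norm first reduces
the problem to the truncation `v` of `u` to `[-k, k]`. On the set where `M_p g ≤ σ` the Poincaré
inequality bounds the mean oscillation of `v` over every ball centred in the set by a constant times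
`σ` times the radius. Telescoping over balls shrinking to a Lebesgue point shows that, up to a null
set, `v` is `Kσ`-Lipschitz there, and a McShane extension `f`, again truncated to `[-k, k]`, agrees
with `v` almost everywhere off `E = {M_p g > σ}`.

The function `v - f` has the upper gradient `g + Kσ`. As it vanishes a.e. off `E`, this upper
gradient may be cut down to `E`: only the parts of a curve before its first and after its last visit
to the zero set contribute to the increment, and an arbitrarily small multiple of `g` takes care of
the curves along which `g` is not integrable. Hence the Newtonian norm of `v - f` is controlled by
`‖g χ_E‖_X` and `‖σ χ_E‖_X`. The latter tends to zero as `σ → ∞` by assumption, which also forces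
`M_p g` to be finite a.e., so that the former tends to zero by absolute continuity.
-/

namespace IsDoublingMetricMeasure

variable {P : Type*} [MetricSpace P] [MeasurableSpace P] {μ : Measure P}

theorem exists_measure_ball_four_mul_le (hμ : IsDoublingMetricMeasure μ) :
    ∃ c : ℝ≥0, ∀ (x : P) (r : ℝ), 0 < r →
      μ (Metric.ball x (4 * r)) ≤ c * μ (Metric.ball x r) := by
  obtain ⟨c, hc⟩ := hμ.doubling
  refine ⟨c * c, fun x r hr => ?_⟩
  calc μ (Metric.ball x (4 * r)) = μ (Metric.ball x (2 * (2 * r))) := by ring_nf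
    _ ≤ c * μ (Metric.ball x (2 * r)) := hc x _ (by positivity)
    _ ≤ c * (c * μ (Metric.ball x r)) := by gcongr; exact hc x r hr
    _ = ↑(c * c) * μ (Metric.ball x r) := by rw [ENNReal.coe_mul, mul_assoc]

theorem sigmaFinite (hμ : IsDoublingMetricMeasure μ) : SigmaFinite μ := by
  rcases isEmpty_or_nonempty P with _ | ⟨⟨x⟩⟩
  · rw [Measure.eq_zero_of_isEmpty μ]
    infer_instance
  · exact ⟨⟨fun n : ℕ => Metric.ball x (n + 1), fun _ => trivial,
      fun n => hμ.ball_lt_top x _ (by positivity), Metric.iUnion_ball_nat_succ x⟩⟩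

theorem isLocallyFiniteMeasure (hμ : IsDoublingMetricMeasure μ) : IsLocallyFiniteMeasure μ :=
  ⟨fun x => ⟨Metric.ball x 1, Metric.ball_mem_nhds x one_pos, hμ.ball_lt_top x 1 one_pos⟩⟩

theorem isUnifLocDoublingMeasure (hμ : IsDoublingMetricMeasure μ) :
    IsUnifLocDoublingMeasure μ := by
  obtain ⟨c, hc⟩ := hμ.exists_measure_ball_four_mul_le
  refine ⟨⟨c, ?_⟩⟩
  filter_upwards [self_mem_nhdsWithin] with r (hr : 0 < r) x
  calc μ (Metric.closedBall x (2 * r)) ≤ μ (Metric.ball x (4 * r)) :=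
        measure_mono (Metric.closedBall_subset_ball (by linarith))
    _ ≤ c * μ (Metric.ball x r) := hc x r hr
    _ ≤ c * μ (Metric.closedBall x r) := by gcongr; exact Metric.ball_subset_closedBall

theorem countable_of_pairwise_lt_dist [OpensMeasurableSpace P] (hμ : IsDoublingMetricMeasure μ)
    {ε : ℝ} (hε : 0 < ε) {s : Set P} (hs : s.Pairwise fun x y => ε < dist x y) :
    s.Countable := by
  have := hμ.sigmaFinite
  have hdisj : Pairwise (Function.onFun Disjoint fun x : s => Metric.ball (x : P) (ε / 2)) :=
    fun x y hxy => Metric.ball_disjoint_ball <| by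
      linarith [hs x.2 y.2 (Subtype.coe_injective.ne hxy)]
  have hcount := Measure.countable_meas_pos_of_disjoint_iUnion (μ := μ)
    (fun _ => Metric.isOpen_ball.measurableSet) hdisj
  have huniv : {x : s | 0 < μ (Metric.ball (x : P) (ε / 2))} = Set.univ :=
    Set.eq_univ_of_forall fun x => hμ.ball_pos x _ (by positivity)
  rw [huniv, Set.countable_univ_iff] at hcount
  exact Set.countable_coe_iff.1 hcount

theorem secondCountableTopology [OpensMeasurableSpace P] (hμ : IsDoublingMetricMeasure μ) :
    SecondCountableTopology P := by
  refine Metric.secondCountable_of_almost_dense_set fun ε hε => ?_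
  obtain ⟨s, hs⟩ := zorn_subset {s : Set P | s.Pairwise fun x y => ε < dist x y}
    fun c hc hchain => ⟨⋃₀ c, (Set.pairwise_sUnion hchain.directedOn).2 hc,
      fun _ => Set.subset_sUnion_of_mem⟩
  refine ⟨s, hμ.countable_of_pairwise_lt_dist hε hs.prop, fun x => ?_⟩
  by_contra! hx
  have hinsert : (insert x s).Pairwise fun x y => ε < dist x y :=
    hs.prop.insert fun y hy _ => ⟨hx y hy, dist_comm x y ▸ hx y hy⟩
  have hxs : x ∈ s := hs.le_of_ge hinsert (Set.subset_insert x s) (Set.mem_insert x s)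
  exact (hx x hxs).not_ge ((dist_self x).trans_le hε.le)

end IsDoublingMetricMeasure

section MeanOscillation

variable {α E : Type*} [MeasurableSpace α] [NormedAddCommGroup E] [NormedSpace ℝ E]
  {μ : Measure α}

theorem setLAverage_le_mul_setLAverage {A B : Set α} (hAB : A ⊆ B) (hA : μ A ≠ 0)
    (hB : μ B ≠ ∞) {c : ℝ≥0∞} (hc : μ B ≤ c * μ A) (f : α → ℝ≥0∞) :
    ⨍⁻ x in A, f x ∂μ ≤ c * ⨍⁻ x in B, f x ∂μ := by
  have hB' : μ B ≠ 0 := fun h => hA (measure_mono_null hAB h)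
  have hinv : (μ A)⁻¹ ≤ c * (μ B)⁻¹ := by
    rw [← div_eq_mul_inv, ENNReal.le_div_iff_mul_le (.inl hB') (.inl hB), mul_comm,
      ← div_eq_mul_inv]
    exact ENNReal.div_le_of_le_mul hc
  calc ⨍⁻ x in A, f x ∂μ = (μ A)⁻¹ * ∫⁻ x in A, f x ∂μ := by
        rw [setLAverage_eq, div_eq_mul_inv, mul_comm]
    _ ≤ (c * (μ B)⁻¹) * ∫⁻ x in B, f x ∂μ := by gcongr
    _ = c * ⨍⁻ x in B, f x ∂μ := by rw [setLAverage_eq, div_eq_mul_inv, mul_assoc, mul_comm (μ B)⁻¹]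

theorem enorm_average_sub_le_laverage [CompleteSpace E] [IsFiniteMeasure μ] [NeZero μ]
    {f : α → E} (hf : Integrable f μ) (a : E) :
    ‖(⨍ x, f x ∂μ) - a‖ₑ ≤ ⨍⁻ x, ‖f x - a‖ₑ ∂μ := by
  have hsub : (⨍ x, f x ∂μ) - a = ⨍ x, (f x - a) ∂μ := by
    conv_lhs => rw [← average_const μ a]
    exact (integral_sub hf.to_average (integrable_const a).to_average).symm
  exact hsub ▸ enorm_integral_le_lintegral_enorm _

end MeanOscillation

section LebesguePoints

variable {P E : Type*} [MetricSpace P] [MeasurableSpace P] [NormedAddCommGroup E]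
  [NormedSpace ℝ E] {μ : Measure P} {v : P → E} {L C : ℝ≥0} {x y : P} {r : ℝ}

/-- The point `x` is a Lebesgue point of `v` in the weak sense that the means of `v` over small
balls around `x` converge to `v x`. The balls are closed, as in Mathlib's Lebesgue
differentiation theorem. -/
def IsLebesguePoint (μ : Measure P) (v : P → E) (x : P) : Prop :=
  Tendsto (fun r => ⨍ y in Metric.closedBall x r, v y ∂μ) (𝓝[>] 0) (𝓝 (v x))

/-- The mean oscillation of `v` over each ball centred at `x` is at most `L` times the radius, that
is, Calderón's first order sharp maximal function of `v` is at most `L` at `x`. -/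
def HasLinearMeanOscillation (μ : Measure P) (v : P → E) (L : ℝ≥0) (x : P) : Prop :=
  ∀ r : ℝ, 0 < r → ⨍⁻ z in Metric.ball x r, ‖v z - ⨍ y in Metric.ball x r, v y ∂μ‖ₑ ∂μ ≤
    L * ENNReal.ofReal r

theorem ae_isLebesguePoint [BorelSpace P] [SecondCountableTopology P]
    [IsUnifLocDoublingMeasure μ] [IsLocallyFiniteMeasure μ] [CompleteSpace E]
    (hv : LocallyIntegrable v μ) : ∀ᵐ x ∂μ, IsLebesguePoint μ v x := by
  filter_upwards [IsUnifLocDoublingMeasure.ae_tendsto_average μ hv 1] with x hx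
  refine hx (fun _ => x) id tendsto_id ?_
  filter_upwards [self_mem_nhdsWithin] with r (hr : 0 < r)
  simpa using hr.le

variable [CompleteSpace E]

theorem HasLinearMeanOscillation.dist_setAverage_le (hosc : HasLinearMeanOscillation μ v L x)
    (hr : 0 < r) (hv : IntegrableOn v (Metric.ball x r) μ) (hpos : μ (Metric.ball x r) ≠ 0)
    (hfin : μ (Metric.ball x r) ≠ ∞) {A : Set P} (hA : A ⊆ Metric.ball x r)
    (hC : μ (Metric.ball x r) ≤ C * μ A) :
    dist (⨍ y in A, v y ∂μ) (⨍ y in Metric.ball x r, v y ∂μ) ≤ C * L * r := by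
  have hA0 : μ A ≠ 0 := fun h => hpos <| by simpa [h] using hC
  have : NeZero (μ.restrict A) := ⟨by rwa [Ne, Measure.restrict_eq_zero]⟩
  have : IsFiniteMeasure (μ.restrict A) := ⟨by simpa using (measure_mono hA).trans_lt hfin.lt_top⟩
  have hnorm : ‖(⨍ y in A, v y ∂μ) - ⨍ y in Metric.ball x r, v y ∂μ‖ₑ ≤
      ENNReal.ofReal (C * L * r) :=
    calc _ ≤ ⨍⁻ z in A, ‖v z - ⨍ y in Metric.ball x r, v y ∂μ‖ₑ ∂μ :=
          enorm_average_sub_le_laverage (hv.mono_set hA) _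
      _ ≤ C * ⨍⁻ z in Metric.ball x r, ‖v z - ⨍ y in Metric.ball x r, v y ∂μ‖ₑ ∂μ :=
          setLAverage_le_mul_setLAverage hA hA0 hfin hC _
      _ ≤ C * (L * ENNReal.ofReal r) := by gcongr; exact hosc r hr
      _ = ENNReal.ofReal (C * L * r) := by
          rw [ENNReal.ofReal_mul (by positivity), ENNReal.ofReal_mul (by positivity),
            ENNReal.ofReal_coe_nnreal, ENNReal.ofReal_coe_nnreal, mul_assoc]
  rw [← ofReal_norm, ← dist_eq_norm] at hnorm
  exact (ENNReal.ofReal_le_ofReal_iff (by positivity)).1 hnorm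

variable (hμ : IsDoublingMetricMeasure μ)
  (hC : ∀ (x : P) (r : ℝ), 0 < r → μ (Metric.ball x (4 * r)) ≤ C * μ (Metric.ball x r))
  (hv : ∀ (x : P) (r : ℝ), 0 < r → IntegrableOn v (Metric.ball x r) μ)

include hμ hC hv

theorem IsLebesguePoint.dist_setAverage_closedBall_le (hx : IsLebesguePoint μ v x)
    (hosc : HasLinearMeanOscillation μ v L x) (hr : 0 < r) :
    dist (⨍ y in Metric.closedBall x r, v y ∂μ) (v x) ≤ 8 * (C * L) * r := by
  have hcompare : ∀ s t : ℝ, 0 < t → s < 4 * t → t ≤ s →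
      dist (⨍ y in Metric.closedBall x s, v y ∂μ) (⨍ y in Metric.ball x (4 * t), v y ∂μ) ≤
        C * L * (4 * t) := fun s t ht hst hts => by
    refine hosc.dist_setAverage_le (by positivity) (hv _ _ (by positivity))
      (hμ.ball_pos x _ (by positivity)).ne' (hμ.ball_lt_top x _ (by positivity)).ne
      (Metric.closedBall_subset_ball hst) ((hC x t ht).trans ?_)
    gcongr
    exact (Metric.ball_subset_ball hts).trans Metric.ball_subset_closedBall
  have hlim : Tendsto (fun n : ℕ => r / 2 ^ n) atTop (𝓝[>] 0) := by
    refine tendsto_nhdsWithin_iff.2 ⟨?_, Eventually.of_forall fun n => Set.mem_Ioi.2 <| by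
      positivity⟩
    exact tendsto_const_nhds.div_atTop (tendsto_pow_atTop_atTop_of_one_lt one_lt_two)
  have hstep : ∀ n : ℕ, dist (⨍ y in Metric.closedBall x (r / 2 ^ n), v y ∂μ)
      (⨍ y in Metric.closedBall x (r / 2 ^ (n + 1)), v y ∂μ) ≤ 8 * (C * L) * r / 2 / 2 ^ n := by
    intro n
    have ht : 0 < r / 2 ^ (n + 1) := by positivity
    have hs : r / 2 ^ n = 2 * (r / 2 ^ (n + 1)) := by rw [pow_succ]; field_simp
    refine (dist_triangle_right _ _ _).trans ((add_le_add
      (hcompare (r / 2 ^ n) _ ht (by linarith) (by linarith))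
      (hcompare (r / 2 ^ (n + 1)) _ ht (by linarith) le_rfl)).trans_eq ?_)
    rw [pow_succ]
    field_simp
    ring
  simpa using dist_le_of_le_geometric_two_of_tendsto₀ hstep (hx.comp hlim)

theorem IsLebesguePoint.dist_le (hx : IsLebesguePoint μ v x) (hy : IsLebesguePoint μ v y)
    (hoscx : HasLinearMeanOscillation μ v L x) (hoscy : HasLinearMeanOscillation μ v L y) :
    dist (v x) (v y) ≤ 22 * (C * L) * dist x y := by
  rcases eq_or_ne x y with rfl | hxy
  · simp
  set d := dist x y
  have hd0 : 0 < d := dist_pos.2 hxy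
  have hmean : ∀ z, Metric.closedBall z d ⊆ Metric.ball x (3 * d) →
      Metric.ball x (3 * d) ⊆ Metric.ball z (4 * d) →
      dist (⨍ w in Metric.closedBall z d, v w ∂μ) (⨍ w in Metric.ball x (3 * d), v w ∂μ) ≤
        C * L * (3 * d) := fun z hz hz' =>
    hoscx.dist_setAverage_le (by positivity) (hv _ _ (by positivity))
      (hμ.ball_pos x _ (by positivity)).ne' (hμ.ball_lt_top x _ (by positivity)).ne hz <|
      calc μ (Metric.ball x (3 * d)) ≤ μ (Metric.ball z (4 * d)) := measure_mono hz'
        _ ≤ C * μ (Metric.ball z d) := hC z d hd0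
        _ ≤ C * μ (Metric.closedBall z d) := by gcongr; exact Metric.ball_subset_closedBall
  have hmeanx := hmean x (Metric.closedBall_subset_ball (by linarith))
    (Metric.ball_subset_ball (by linarith))
  have hmeany := hmean y (Metric.closedBall_subset_ball' (by rw [dist_comm y x]; linarith))
    (Metric.ball_subset_ball' (by linarith))
  have hx' := hx.dist_setAverage_closedBall_le hμ hC hv hoscx hd0
  have hy' := hy.dist_setAverage_closedBall_le hμ hC hv hoscy hd0
  rw [dist_comm] at hx'
  have htri := dist_triangle4 (v x) (⨍ w in Metric.closedBall x d, v w ∂μ)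
    (⨍ w in Metric.closedBall y d, v w ∂μ) (v y)
  have hmid := dist_triangle_right (⨍ w in Metric.closedBall x d, v w ∂μ)
    (⨍ w in Metric.closedBall y d, v w ∂μ) (⨍ w in Metric.ball x (3 * d), v w ∂μ)
  linarith

end LebesguePoints

section ExtendedReals

theorem ereal_abs_coe (x : ℝ) : (x : EReal).abs = ‖x‖ₑ := by
  rw [EReal.abs_def, Real.enorm_eq_ofReal_abs]

theorem ereal_abs_coe_sub_coe (x y : ℝ) : ((x : EReal) - (y : EReal)).abs = ‖x - y‖ₑ := by
  rw [← EReal.coe_sub, ereal_abs_coe]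

theorem ereal_abs_coe_ennreal (a : ℝ≥0∞) : (a : EReal).abs = a := by
  induction a with
  | top => rfl
  | coe a => exact (ereal_abs_coe a).trans (NNReal.enorm_eq a)

theorem measurable_ereal_abs : Measurable EReal.abs :=
  EReal.measurable_of_measurable_real <| by
    simpa only [Function.comp_def, ereal_abs_coe] using measurable_enorm

theorem ereal_abs_sub_eq_top_or_exists_coe (a b : EReal) :
    (a - b).abs = ⊤ ∨ ∃ x y : ℝ, a = x ∧ b = y := by
  induction a <;> induction b <;> simp [← EReal.coe_sub]

theorem ereal_coe_ennreal_natCast (n : ℕ) : ((n : ℝ≥0∞) : EReal) = n := by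
  rw [← ENNReal.coe_natCast, EReal.coe_nnreal_eq_coe_real, NNReal.coe_natCast, EReal.coe_natCast]

theorem ereal_sub_coe_add_coe_sub_coe (a : EReal) (x y : ℝ) :
    a - (x : EReal) + ((x : EReal) - (y : EReal)) = a - (y : EReal) := by
  induction a with
  | bot => simp
  | top => simp [← EReal.coe_sub]
  | coe a => simp only [← EReal.coe_sub, ← EReal.coe_add, sub_add_sub_cancel]

end ExtendedReals

section MaximalFunction

theorem ediam_ball_le_ofReal {α : Type*} [PseudoMetricSpace α] (x : α) (r : ℝ) :
    Metric.ediam (Metric.ball x r) ≤ ENNReal.ofReal (2 * r) := by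
  rw [← Metric.eball_ofReal, ENNReal.ofReal_mul zero_le_two, ENNReal.ofReal_ofNat]
  exact Metric.ediam_eball_le

variable {P : Type*} [MetricSpace P] [MeasurableSpace P] {μ : Measure P} {p : ℝ}

theorem laverage_ball_le_maximalFunction (u : P → EReal) {x y : P} {r : ℝ} (hr : 0 < r)
    (hx : x ∈ Metric.ball y r) :
    (⨍⁻ z in Metric.ball y r, (u z).abs ^ p ∂μ) ^ (1 / p) ≤ maximalFunction μ p u x :=
  le_iSup_of_le y (le_iSup_of_le r (le_iSup_of_le hr (le_iSup_of_le hx le_rfl)))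

theorem lowerSemicontinuous_maximalFunction (u : P → EReal) :
    LowerSemicontinuous (maximalFunction μ p u) := by
  intro x a ha
  simp only [maximalFunction, lt_iSup_iff] at ha
  obtain ⟨y, r, hr, hxy, ha⟩ := ha
  filter_upwards [Metric.isOpen_ball.mem_nhds hxy] with z hz
  exact ha.trans_le (laverage_ball_le_maximalFunction u hr hz)

theorem measurable_maximalFunction [BorelSpace P] (u : P → EReal) :
    Measurable (maximalFunction μ p u) :=
  (lowerSemicontinuous_maximalFunction u).measurable

theorem SupportsPoincare.exists_hasLinearMeanOscillation (hP : SupportsPoincare μ p) :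
    ∃ c : ℝ≥0, ∀ (v : P → ℝ) (g : P → ℝ≥0∞), IsLocallyIntegrable μ (fun x => (v x : EReal)) →
      IsUpperGradient g (fun x => (v x : EReal)) → ∀ (σ : ℝ≥0) (x : P),
        maximalFunction μ p (fun x => (g x : EReal)) x ≤ σ →
          HasLinearMeanOscillation μ v (c * σ) x := by
  obtain ⟨c, -, lam, hlam, hP⟩ := hP
  refine ⟨c * 2, fun v g hv hg σ x hx r hr => ?_⟩
  have hgσ : (⨍⁻ z in Metric.ball x (lam * r), g z ^ p ∂μ) ^ (1 / p) ≤ σ := by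
    have hr' : 0 < lam * r := by positivity
    simpa only [ereal_abs_coe_ennreal] using
      (laverage_ball_le_maximalFunction _ hr' (Metric.mem_ball_self hr')).trans hx
  have hPv := hP x r hr _ hv g hg
  simp only [EReal.toReal_coe, ereal_abs_coe_sub_coe] at hPv
  calc _ ≤ _ := hPv
    _ ≤ c * ENNReal.ofReal (2 * r) * σ := by gcongr; exact ediam_ball_le_ofReal x r
    _ = ↑(c * 2 * σ) * ENNReal.ofReal r := by
      rw [ENNReal.ofReal_mul zero_le_two, ENNReal.ofReal_ofNat]
      push_cast
      ring

theorem IsLocallyIntegrable.integrableOn_ball {v : P → ℝ}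
    (hv : IsLocallyIntegrable μ fun x => (v x : EReal)) (x : P) (r : ℝ) (hr : 0 < r) :
    IntegrableOn v (Metric.ball x r) μ := by
  have hvm : AEMeasurable v μ := by simpa using hv.1.ereal_toReal
  refine ⟨hvm.aestronglyMeasurable.restrict, ?_⟩
  simpa only [HasFiniteIntegral, ereal_abs_coe] using hv.2 x r hr

theorem IsLocallyIntegrable.locallyIntegrable {v : P → ℝ}
    (hv : IsLocallyIntegrable μ fun x => (v x : EReal)) : LocallyIntegrable v μ :=
  fun x => ⟨Metric.ball x 1, Metric.ball_mem_nhds x one_pos, hv.integrableOn_ball x 1 one_pos⟩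

theorem IsDoublingMetricMeasure.isLocallyIntegrable_of_abs_le (hμ : IsDoublingMetricMeasure μ)
    {v : P → ℝ} (hv : AEMeasurable v μ) {k : ℝ} (hk : ∀ x, |v x| ≤ k) :
    IsLocallyIntegrable μ fun x => (v x : EReal) := by
  refine ⟨hv.coe_real_ereal, fun x r hr => ?_⟩
  simp only [ereal_abs_coe]
  exact (Measure.integrableOn_of_bounded (hμ.ball_lt_top x r hr).ne hv.aestronglyMeasurable
    (Eventually.of_forall hk)).hasFiniteIntegral

theorem SupportsPoincare.exists_lipschitzOnWith (hP : SupportsPoincare μ p)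
    (hμ : IsDoublingMetricMeasure μ) :
    ∃ K : ℝ≥0, ∀ (v : P → ℝ) (g : P → ℝ≥0∞), IsLocallyIntegrable μ (fun x => (v x : EReal)) →
      IsUpperGradient g (fun x => (v x : EReal)) → ∀ σ : ℝ≥0, LipschitzOnWith (K * σ) v
        {x | IsLebesguePoint μ v x ∧ maximalFunction μ p (fun x => (g x : EReal)) x ≤ σ} := by
  obtain ⟨C, hC⟩ := hμ.exists_measure_ball_four_mul_le
  obtain ⟨c, hc⟩ := hP.exists_hasLinearMeanOscillation
  refine ⟨22 * (C * c), fun v g hv hg σ => LipschitzOnWith.of_dist_le_mul ?_⟩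
  rintro x ⟨hx, hxσ⟩ y ⟨hy, hyσ⟩
  have hle := hx.dist_le hμ hC hv.integrableOn_ball hy (hc v g hv hg σ x hxσ)
    (hc v g hv hg σ y hyσ)
  push_cast at hle ⊢
  linarith

end MaximalFunction

section Curves

theorem hasUnitSpeedOn_of_subset {E : Type*} [PseudoEMetricSpace E] {γ : ℝ → E} {s t : Set ℝ}
    [s.OrdConnected] (h : HasUnitSpeedOn γ t) (hst : s ⊆ t) : HasUnitSpeedOn γ s := by
  intro x hx y hy
  have hIcc : Set.Icc x y ⊆ s := Set.Icc_subset s hx hy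
  rw [← h (hst hx) (hst hy), Set.inter_eq_right.2 hIcc, Set.inter_eq_right.2 (hIcc.trans hst)]

theorem hasUnitSpeedOn_comp_add_right {E : Type*} [PseudoEMetricSpace E] {γ : ℝ → E} {s : Set ℝ}
    (h : HasUnitSpeedOn γ s) (a : ℝ) :
    HasUnitSpeedOn (fun t => γ (t + a)) ((fun t => t + a) ⁻¹' s) := by
  intro x hx y hy
  have himage : (fun t => t + a) '' ((fun t => t + a) ⁻¹' s ∩ Set.Icc x y) =
      s ∩ Set.Icc (x + a) (y + a) := by
    rw [Set.image_preimage_inter, Set.image_add_const_Icc]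
  have hcomp := eVariationOn.comp_eq_of_monotoneOn γ (t := (fun t => t + a) ⁻¹' s ∩ Set.Icc x y)
    (fun t => t + a) (fun _ _ _ _ hst => add_le_add_left hst a)
  rw [himage, h hx hy, add_sub_add_right_eq_sub] at hcomp
  exact hcomp

theorem edist_le_ofReal_of_hasUnitSpeedOn {E : Type*} [PseudoEMetricSpace E] {γ : ℝ → E}
    {s : Set ℝ} (h : HasUnitSpeedOn γ s) {x y : ℝ} (hx : x ∈ s) (hy : y ∈ s) (hxy : x ≤ y) :
    edist (γ x) (γ y) ≤ ENNReal.ofReal (y - x) := by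
  have hlen := h hx hy
  rw [NNReal.coe_one, one_mul] at hlen
  exact hlen ▸ eVariationOn.edist_le γ ⟨hx, le_rfl, hxy⟩ ⟨hy, hxy, le_rfl⟩

variable {E : Type*} {a b : ℝ} {h : ℝ → ℝ≥0∞} {φ : ℝ → E}

theorem continuousOn_of_edist_le_setLIntegral [PseudoEMetricSpace E]
    (hfin : ∫⁻ t in Set.Icc a b, h t ≠ ∞)
    (hφ : ∀ s ∈ Set.Icc a b, ∀ t ∈ Set.Icc a b, s ≤ t →
      edist (φ s) (φ t) ≤ ∫⁻ r in Set.Icc s t, h r) :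
    ContinuousOn φ (Set.Icc a b) := by
  rw [EMetric.continuousOn_iff]
  intro s hs ε hε
  obtain ⟨δ, hδ, hδε⟩ := exists_pos_setLIntegral_lt_of_measure_lt hfin hε.ne'
  have hlt : ∀ x ∈ Set.Icc a b, ∀ y ∈ Set.Icc a b, x ≤ y → edist x y < δ →
      edist (φ x) (φ y) < ε := by
    intro x hx y hy hxy hd
    have hvol : volume.restrict (Set.Icc a b) (Set.Icc x y) < δ := by
      refine (Measure.restrict_apply_le _ _).trans_lt ?_
      rwa [Real.volume_Icc, ← abs_of_nonneg (sub_nonneg.2 hxy), ← Real.dist_eq, ← edist_dist,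
        edist_comm]
    have hint := hδε _ hvol
    rw [Measure.restrict_restrict_of_subset (Set.Icc_subset_Icc hx.1 hy.2)] at hint
    exact (hφ x hx y hy hxy).trans_lt hint
  refine ⟨δ, hδ, fun t ht hd => ?_⟩
  rcases le_total t s with hts | hst
  · exact hlt t ht s hs hts hd
  · rw [edist_comm] at hd ⊢
    exact hlt s hs t ht hst hd

-- Only the parts of the path before the first and after the last visit to `c` contribute to the
-- increment, and on these parts the path stays over `S`.
theorem edist_le_setLIntegral_indicator [EMetricSpace E] (hab : a ≤ b)
    (hfin : ∫⁻ t in Set.Icc a b, h t ≠ ∞)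
    (hφ : ∀ s ∈ Set.Icc a b, ∀ t ∈ Set.Icc a b, s ≤ t →
      edist (φ s) (φ t) ≤ ∫⁻ r in Set.Icc s t, h r)
    {S : Set ℝ} {c : E} (hS : ∀ t ∈ Set.Icc a b, t ∉ S → φ t = c) :
    edist (φ a) (φ b) ≤ ∫⁻ t in Set.Icc a b, S.indicator h t := by
  set Z : Set ℝ := Set.Icc a b ∩ φ ⁻¹' {c}
  have hZ : IsCompact Z := isCompact_Icc.of_isClosed_subset
    ((continuousOn_of_edist_le_setLIntegral hfin hφ).preimage_isClosed_of_isClosed isClosed_Icc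
      isClosed_singleton) Set.inter_subset_left
  have hind : ∀ J ⊆ Set.Icc a b, MeasurableSet J → (∀ t ∈ J, t ∉ Z) →
      ∫⁻ t in J, h t = ∫⁻ t in J, S.indicator h t := fun J hJ hJm hJZ =>
    setLIntegral_congr_fun hJm fun t ht => (Set.indicator_of_mem
      (by_contra fun htS => hJZ t ht ⟨hJ ht, hS t (hJ ht) htS⟩) h).symm
  have ha : a ∈ Set.Icc a b := Set.left_mem_Icc.2 hab
  have hb : b ∈ Set.Icc a b := Set.right_mem_Icc.2 hab
  rcases Z.eq_empty_or_nonempty with hempty | hne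
  · exact (hφ a ha b hb hab).trans_eq
      (hind _ le_rfl measurableSet_Icc fun t _ => hempty ▸ Set.notMem_empty t)
  obtain ⟨s, ⟨hs, hφs⟩, hfirst⟩ := hZ.exists_isLeast hne
  obtain ⟨t, ⟨ht, hφt⟩, hlast⟩ := hZ.exists_isGreatest hne
  have hst : s ≤ t := hfirst ⟨ht, hφt⟩
  have hIco : Set.Ico a s ⊆ Set.Icc a b := fun r hr => ⟨hr.1, hr.2.le.trans hs.2⟩
  have hIoc : Set.Ioc t b ⊆ Set.Icc a b := fun r hr => ⟨ht.1.trans hr.1.le, hr.2⟩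
  calc edist (φ a) (φ b) ≤ edist (φ a) (φ s) + edist (φ t) (φ b) := by
        rw [show φ s = c from hφs, show φ t = c from hφt]
        exact edist_triangle _ _ _
    _ ≤ (∫⁻ r in Set.Icc a s, h r) + ∫⁻ r in Set.Icc t b, h r :=
        add_le_add (hφ a ha s hs hs.1) (hφ t ht b hb ht.2)
    _ = (∫⁻ r in Set.Ico a s, h r) + ∫⁻ r in Set.Ioc t b, h r := by
        rw [setLIntegral_congr Ico_ae_eq_Icc, setLIntegral_congr Ioc_ae_eq_Icc]
    _ = (∫⁻ r in Set.Ico a s, S.indicator h r) + ∫⁻ r in Set.Ioc t b, S.indicator h r :=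
        congrArg₂ _ (hind _ hIco measurableSet_Ico fun r hr hrZ => (hfirst hrZ).not_gt hr.2)
          (hind _ hIoc measurableSet_Ioc fun r hr hrZ => (hlast hrZ).not_gt hr.1)
    _ = ∫⁻ r in Set.Ico a s ∪ Set.Ioc t b, S.indicator h r :=
        (lintegral_union measurableSet_Ioc <| Set.disjoint_left.2 fun r hr hr' =>
          (hr.2.trans_le hst).not_gt hr'.1).symm
    _ ≤ ∫⁻ r in Set.Icc a b, S.indicator h r := lintegral_mono_set (Set.union_subset hIco hIoc)

end Curves

namespace IsUpperGradient

variable {P : Type*} [MetricSpace P] [MeasurableSpace P] {g h : P → ℝ≥0∞} {u w : P → EReal}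
  {l : ℝ} {γ : ℝ → P}

theorem abs_sub_le (hg : IsUpperGradient g u) (hγ : HasUnitSpeedOn γ (Set.Icc 0 l)) {a b : ℝ}
    (ha : a ∈ Set.Icc 0 l) (hb : b ∈ Set.Icc 0 l) (hab : a < b) :
    (u (γ a) - u (γ b)).abs ≤ ∫⁻ t in Set.Icc a b, g (γ t) := by
  have hshift : (fun t => t + a) ⁻¹' Set.Icc a b = Set.Icc 0 (b - a) := by
    rw [Set.preimage_add_const_Icc, sub_self]
  have hγ' := hasUnitSpeedOn_comp_add_right
    (hasUnitSpeedOn_of_subset hγ (Set.Icc_subset_Icc ha.1 hb.2)) a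
  have hint := (measurePreserving_add_right volume a).setLIntegral_comp_preimage_emb
    (measurableEmbedding_addRight a) (fun t => g (γ t)) (Set.Icc a b)
  rw [hshift] at hγ' hint
  simpa [hint] using hg.2 (b - a) _ (sub_pos.2 hab) hγ'

theorem coe_toReal_of_lintegral_ne_top (hg : IsUpperGradient g u) (hl : 0 < l)
    (hγ : HasUnitSpeedOn γ (Set.Icc 0 l)) (hfin : ∫⁻ t in Set.Icc 0 l, g (γ t) ≠ ∞)
    {t : ℝ} (ht : t ∈ Set.Icc 0 l) : ((u (γ t)).toReal : EReal) = u (γ t) := by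
  have hlt : ∀ s ∈ Set.Icc 0 l, 0 < s → ∃ x y : ℝ, u (γ 0) = x ∧ u (γ s) = y := fun s hs hs0 =>
    (ereal_abs_sub_eq_top_or_exists_coe _ _).resolve_left <| ne_top_of_le_ne_top hfin <|
      (hg.abs_sub_le hγ (Set.left_mem_Icc.2 hl.le) hs hs0).trans
        (lintegral_mono_set (Set.Icc_subset_Icc_right hs.2))
  rcases ht.1.eq_or_lt with rfl | ht0
  · obtain ⟨x, -, hx, -⟩ := hlt l (Set.right_mem_Icc.2 hl.le) hl
    rw [hx, EReal.toReal_coe]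
  · obtain ⟨-, y, -, hy⟩ := hlt t ht ht0
    rw [hy, EReal.toReal_coe]

theorem mono (hg : IsUpperGradient g u) (hh : Measurable h) (hgh : g ≤ h)
    (hwu : ∀ x y, (w x - w y).abs ≤ (u x - u y).abs) : IsUpperGradient h w :=
  ⟨hh, fun l γ hl hγ => (hwu _ _).trans
    ((hg.2 l γ hl hγ).trans (lintegral_mono fun _ => hgh _))⟩

theorem add (hg : IsUpperGradient g u) (hh : IsUpperGradient h w) :
    IsUpperGradient (fun x => g x + h x) (fun x => u x + w x) := by
  refine ⟨hg.1.add hh.1, fun l γ hl hγ => le_trans ?_ (le_lintegral_add _ _)⟩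
  refine le_trans ?_ (add_le_add (hg.2 l γ hl hγ) (hh.2 l γ hl hγ))
  rcases ereal_abs_sub_eq_top_or_exists_coe (u (γ 0)) (u (γ l)) with hu | ⟨x, y, hx, hy⟩
  · simp [hu]
  rcases ereal_abs_sub_eq_top_or_exists_coe (w (γ 0)) (w (γ l)) with hw | ⟨x', y', hx', hy'⟩
  · simp [hw]
  simp only [hx, hy, hx', hy', ← EReal.coe_add, ereal_abs_coe_sub_coe, add_sub_add_comm]
  exact enorm_add_le _ _

theorem neg (hg : IsUpperGradient g u) : IsUpperGradient g (fun x => -u x) := by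
  refine hg.mono hg.1 le_rfl fun x y => ?_
  rcases ereal_abs_sub_eq_top_or_exists_coe (u x) (u y) with hu | ⟨a, b, ha, hb⟩
  · simp [hu]
  · rw [ha, hb, ← EReal.coe_neg, ← EReal.coe_neg, ereal_abs_coe_sub_coe, ereal_abs_coe_sub_coe,
      ← edist_eq_enorm_sub, edist_neg_neg, edist_eq_enorm_sub]

theorem of_lipschitzWith {K : ℝ≥0} {f : P → ℝ} (hf : LipschitzWith K f) :
    IsUpperGradient (fun _ => (K : ℝ≥0∞)) (fun x => (f x : EReal)) := by
  refine ⟨measurable_const, fun l γ hl hγ => ?_⟩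
  calc ((f (γ 0) : EReal) - (f (γ l) : EReal)).abs = edist (f (γ 0)) (f (γ l)) := by
        rw [ereal_abs_coe_sub_coe, edist_eq_enorm_sub]
    _ ≤ K * edist (γ 0) (γ l) := hf _ _
    _ ≤ K * ENNReal.ofReal (l - 0) := by
        gcongr
        exact edist_le_ofReal_of_hasUnitSpeedOn hγ (Set.left_mem_Icc.2 hl.le)
          (Set.right_mem_Icc.2 hl.le) hl.le
    _ = ∫⁻ _ in Set.Icc 0 l, (K : ℝ≥0∞) := by simp

-- Along the curves on which `g` is not integrable, the multiple of `g` makes the estimate trivial.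
theorem indicator_add (hw : IsUpperGradient h w) (hg : Measurable g) {K δ : ℝ≥0}
    (hhg : ∀ x, h x ≤ g x + K) {F : Set P} (hF : MeasurableSet F) (hwF : ∀ x ∉ F, w x = 0)
    (hδ : δ ≠ 0) : IsUpperGradient (fun x => F.indicator h x + δ * g x) w := by
  refine ⟨(hw.1.indicator hF).add (hg.const_mul _), fun l γ hl hγ => ?_⟩
  by_cases hgfin : ∫⁻ t in Set.Icc 0 l, g (γ t) = ∞
  · refine le_trans ?_ (lintegral_mono fun t => le_add_self)
    simp [lintegral_const_mul' _ _ ENNReal.coe_ne_top, hgfin, hδ]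
  have hhfin : ∫⁻ t in Set.Icc 0 l, h (γ t) ≠ ∞ := by
    refine ne_top_of_le_ne_top ?_ (lintegral_mono fun t => hhg (γ t))
    rw [lintegral_add_right _ measurable_const]
    exact ENNReal.add_ne_top.2 ⟨hgfin, by simp [ENNReal.mul_eq_top]⟩
  have hreal := fun t ht => hw.coe_toReal_of_lintegral_ne_top hl hγ hhfin (t := t) ht
  have habs : ∀ s ∈ Set.Icc 0 l, ∀ t ∈ Set.Icc 0 l, (w (γ s) - w (γ t)).abs =
      edist (w (γ s)).toReal (w (γ t)).toReal := fun s hs t ht => by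
    rw [edist_eq_enorm_sub, ← ereal_abs_coe_sub_coe, hreal s hs, hreal t ht]
  refine le_trans ?_ (lintegral_mono fun t => le_self_add)
  rw [habs 0 (Set.left_mem_Icc.2 hl.le) l (Set.right_mem_Icc.2 hl.le)]
  refine edist_le_setLIntegral_indicator (φ := fun t => (w (γ t)).toReal) (S := γ ⁻¹' F) (c := 0)
    hl.le hhfin (fun s hs t ht hst => ?_) fun t _ ht => by simp [hwF _ ht]
  rcases hst.eq_or_lt with rfl | hst
  · simp
  · exact habs s hs t ht ▸ hw.abs_sub_le hγ hs ht hst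

end IsUpperGradient

namespace QuasiBanachFunctionLattice

section Lattice

variable {P : Type*} [MeasurableSpace P] {μ : Measure P} (X : QuasiBanachFunctionLattice μ)
  {u : P → EReal} {g h : P → ℝ≥0∞}

/-- The quasi-norm of a `[0, ∞]`-valued function. Every quasi-norm is of this form, by the lattice
property, see `qnorm_eq_qnormENNReal_abs`. -/
noncomputable def qnormENNReal (g : P → ℝ≥0∞) : ℝ≥0∞ := X.qnorm fun x => (g x : EReal)

theorem qnormENNReal_mono_ae (hg : AEMeasurable g μ) (hh : AEMeasurable h μ) (hgh : g ≤ᵐ[μ] h) :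
    X.qnormENNReal g ≤ X.qnormENNReal h :=
  X.qnorm_mono _ _ hg.coe_ereal_ennreal hh.coe_ereal_ennreal <| by
    filter_upwards [hgh] with x hx
    simpa only [ereal_abs_coe_ennreal] using hx

theorem qnormENNReal_congr_ae (hg : AEMeasurable g μ) (hgh : g =ᵐ[μ] h) :
    X.qnormENNReal g = X.qnormENNReal h :=
  (X.qnormENNReal_mono_ae hg (hg.congr hgh) hgh.le).antisymm
    (X.qnormENNReal_mono_ae (hg.congr hgh) hg hgh.symm.le)

theorem qnorm_eq_qnormENNReal_abs (hu : AEMeasurable u μ) :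
    X.qnorm u = X.qnormENNReal fun x => (u x).abs := by
  have hu' := (measurable_ereal_abs.comp_aemeasurable hu).coe_ereal_ennreal
  refine le_antisymm (X.qnorm_mono _ _ hu hu' ?_) (X.qnorm_mono _ _ hu' hu ?_) <;>
    simp [ereal_abs_coe_ennreal]

theorem qnorm_le_qnormENNReal (hu : AEMeasurable u μ) (hg : AEMeasurable g μ)
    (hug : ∀ᵐ x ∂μ, (u x).abs ≤ g x) : X.qnorm u ≤ X.qnormENNReal g := by
  rw [X.qnorm_eq_qnormENNReal_abs hu]
  exact X.qnormENNReal_mono_ae (measurable_ereal_abs.comp_aemeasurable hu) hg hug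

theorem qnorm_indicator_coe_ennreal (E : Set P) (g : P → ℝ≥0∞) :
    X.qnorm (E.indicator fun x => (g x : EReal)) = X.qnormENNReal (E.indicator g) :=
  congrArg X.qnorm (Set.indicator_comp_of_zero EReal.coe_ennreal_zero)

theorem qnorm_neg (hu : AEMeasurable u μ) : X.qnorm (fun x => -u x) = X.qnorm u := by
  simpa using X.qnorm_smul (-1) u hu

theorem qnormENNReal_add_le (hg : AEMeasurable g μ) (hh : AEMeasurable h μ) :
    X.qnormENNReal (fun x => g x + h x) ≤
      X.modulus * (X.qnormENNReal g + X.qnormENNReal h) := by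
  simp only [qnormENNReal, EReal.coe_ennreal_add]
  exact X.qnorm_add_le _ _ hg.coe_ereal_ennreal hh.coe_ereal_ennreal

theorem qnormENNReal_const_mul (δ : ℝ≥0) (hg : AEMeasurable g μ) :
    X.qnormENNReal (fun x => δ * g x) = δ * X.qnormENNReal g := by
  have hsmul := X.qnorm_smul δ _ hg.coe_ereal_ennreal
  rw [abs_of_nonneg δ.coe_nonneg, ENNReal.ofReal_coe_nnreal] at hsmul
  simp only [qnormENNReal, EReal.coe_ennreal_mul, ← hsmul]
  rfl

theorem qnormENNReal_indicator_const_mul {E : Set P} (hE : NullMeasurableSet E μ) (δ : ℝ≥0)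
    (a : ℝ≥0∞) : X.qnormENNReal (E.indicator fun _ => δ * a) =
      δ * X.qnormENNReal (E.indicator fun _ => a) := by
  rw [← X.qnormENNReal_const_mul δ (aemeasurable_const.indicator₀ hE)]
  exact congrArg _ (funext fun _ => Set.indicator_const_mul ..)

theorem qnormENNReal_indicator_add_mul_le (hg : AEMeasurable g μ) {E : Set P}
    (hE : NullMeasurableSet E μ) (K : ℝ≥0) (a : ℝ≥0∞) :
    X.qnormENNReal (E.indicator fun x => g x + K * a) ≤
      X.modulus * (X.qnormENNReal (E.indicator g) +
        K * X.qnormENNReal (E.indicator fun _ => a)) := by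
  rw [Set.indicator_add, ← X.qnormENNReal_indicator_const_mul hE]
  exact X.qnormENNReal_add_le (hg.indicator₀ hE) (aemeasurable_const.indicator₀ hE)

theorem ae_eq_zero_of_qnormENNReal_eq_zero (hg : AEMeasurable g μ) (h0 : X.qnormENNReal g = 0) :
    g =ᵐ[μ] 0 := by
  filter_upwards [(X.qnorm_eq_zero_iff _ hg.coe_ereal_ennreal).1 h0] with x hx
  simpa using hx

theorem ae_ne_top_of_eventually_qnormENNReal_indicator_le {F : P → ℝ≥0∞} (hF : AEMeasurable F μ)
    {C : ℝ≥0∞} (hC : C ≠ ∞)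
    (hle : ∀ᶠ n : ℕ in atTop, X.qnormENNReal ({x | n < F x}.indicator fun _ => (n : ℝ≥0∞)) ≤ C) :
    ∀ᵐ x ∂μ, F x ≠ ∞ := by
  have hlt : ∀ n : ℕ, NullMeasurableSet {x | (n : ℝ≥0∞) < F x} μ := fun n =>
    hF.nullMeasurableSet_preimage measurableSet_Ioi
  set z : P → ℝ≥0∞ := {x | F x = ∞}.indicator 1
  have hz : AEMeasurable z μ :=
    aemeasurable_const.indicator₀ (hF.nullMeasurableSet_preimage (measurableSet_singleton ∞))
  have hnz : ∀ n : ℕ, n * X.qnormENNReal z ≤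
      X.qnormENNReal ({x | n < F x}.indicator fun _ => (n : ℝ≥0∞)) := fun n => by
    rw [← ENNReal.coe_natCast, ← X.qnormENNReal_const_mul n hz]
    refine X.qnormENNReal_mono_ae (hz.const_mul _) (aemeasurable_const.indicator₀ (hlt n))
      (Eventually.of_forall fun x => ?_)
    by_cases hx : F x = ∞ <;> simp [z, hx]
  have hz0 : X.qnormENNReal z = 0 := by
    by_contra hne
    obtain ⟨N, hN⟩ := ENNReal.exists_nat_mul_gt hne hC
    obtain ⟨n, hnC, hNn⟩ := (hle.and (eventually_ge_atTop N)).exists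
    refine (hN.trans_le ?_).not_ge ((hnz n).trans hnC)
    gcongr
  filter_upwards [X.ae_eq_zero_of_qnormENNReal_eq_zero hz hz0] with x hx hxF
  simp [z, hxF] at hx

theorem ae_abs_ne_top_of_mem (hu : X.Mem u) : ∀ᵐ x ∂μ, (u x).abs ≠ ∞ := by
  have habs : AEMeasurable (fun x => (u x).abs) μ := measurable_ereal_abs.comp_aemeasurable hu.1
  refine X.ae_ne_top_of_eventually_qnormENNReal_indicator_le habs hu.2.ne
    (Eventually.of_forall fun n => ?_)
  rw [X.qnorm_eq_qnormENNReal_abs hu.1]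
  refine X.qnormENNReal_mono_ae (aemeasurable_const.indicator₀
    (habs.nullMeasurableSet_preimage measurableSet_Ioi)) habs (Eventually.of_forall ?_)
  exact Set.indicator_le fun x (hx : (n : ℝ≥0∞) < (u x).abs) => hx.le

/-- The function `u` has absolutely continuous quasi-norm, that is, it belongs to the order
continuous part of `X`. The quasi-norm of `X` is absolutely continuous when this holds for all
members of `X`. -/
def HasAbsolutelyContinuousNorm (u : P → EReal) : Prop :=
  ∀ E : ℕ → Set P, (∀ n, NullMeasurableSet (E n) μ) → Antitone E → μ (⋂ n, E n) = 0 →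
    Tendsto (fun n => X.qnorm ((E n).indicator u)) atTop (𝓝 0)

variable {X}

theorem HasAbsolutelyContinuousNorm.tendsto_qnorm_indicator_lt
    (hu : X.HasAbsolutelyContinuousNorm u) {F : P → ℝ≥0∞} (hF : AEMeasurable F μ)
    (hF_top : ∀ᵐ x ∂μ, F x ≠ ∞) :
    Tendsto (fun n : ℕ => X.qnorm ({x | n < F x}.indicator u)) atTop (𝓝 0) := by
  refine hu _ (fun n => hF.nullMeasurableSet_preimage measurableSet_Ioi) (fun m n hmn x hx => ?_)
    (measure_mono_null (fun x hx => not_not.2 ?_) (ae_iff.1 hF_top))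
  · exact (Nat.cast_le.2 hmn).trans_lt (Set.mem_ofPred.1 hx)
  · by_contra hne
    obtain ⟨n, hn⟩ := ENNReal.exists_nat_gt hne
    exact (Set.mem_iInter.1 hx n).not_gt hn

end Lattice

section Newton

variable {P : Type*} [MetricSpace P] [MeasurableSpace P] {μ : Measure P}
  (X : QuasiBanachFunctionLattice μ) {u w : P → EReal} {g h : P → ℝ≥0∞}

theorem newtonNorm_le (hg : IsUpperGradient g u) :
    X.newtonNorm u ≤ X.qnorm u + X.qnormENNReal g :=
  add_le_add le_rfl (iInf₂_le g hg)

theorem newtonNorm_eq_iInf (u : P → EReal) :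
    X.newtonNorm u = ⨅ g : {g // IsUpperGradient g u}, X.qnorm u + X.qnormENNReal g := by
  rw [newtonNorm, iInf_subtype', ENNReal.add_iInf]
  rfl

theorem newtonNorm_lt_iff {a : ℝ≥0∞} : X.newtonNorm u < a ↔
    ∃ g, IsUpperGradient g u ∧ X.qnorm u + X.qnormENNReal g < a := by
  simp [newtonNorm_eq_iInf, iInf_lt_iff]

theorem newtonNorm_add_le (hu : AEMeasurable u μ) (hw : AEMeasurable w μ) :
    X.newtonNorm (fun x => u x + w x) ≤ X.modulus * (X.newtonNorm u + X.newtonNorm w) := by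
  have hC : (X.modulus : ℝ≥0∞) ≠ 0 := by
    exact_mod_cast (zero_lt_one.trans_le X.one_le_modulus).ne'
  rw [mul_comm, ← ENNReal.div_le_iff_le_mul (.inl hC) (.inl ENNReal.coe_ne_top),
    X.newtonNorm_eq_iInf u, X.newtonNorm_eq_iInf w]
  refine ENNReal.le_iInf_add_iInf fun ⟨g, hg⟩ ⟨h, hh⟩ => ENNReal.div_le_of_le_mul' ?_
  calc X.newtonNorm (fun x => u x + w x)
      ≤ X.qnorm (fun x => u x + w x) + X.qnormENNReal fun x => g x + h x :=
        X.newtonNorm_le (hg.add hh)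
    _ ≤ X.modulus * (X.qnorm u + X.qnorm w) +
          X.modulus * (X.qnormENNReal g + X.qnormENNReal h) :=
        add_le_add (X.qnorm_add_le u w hu hw)
          (X.qnormENNReal_add_le hg.1.aemeasurable hh.1.aemeasurable)
    _ = X.modulus * (X.qnorm u + X.qnormENNReal g + (X.qnorm w + X.qnormENNReal h)) := by ring

theorem newtonNorm_neg_le (hu : AEMeasurable u μ) :
    X.newtonNorm (fun x => -u x) ≤ X.newtonNorm u := by
  rw [newtonNorm, X.qnorm_neg hu]
  exact add_le_add le_rfl (le_iInf₂ fun g hg => iInf₂_le g hg.neg)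

theorem newtonNorm_sub_le (hu : AEMeasurable u μ) (hw : AEMeasurable w μ) :
    X.newtonNorm (fun x => u x - w x) ≤ X.modulus * (X.newtonNorm u + X.newtonNorm w) := by
  simp only [sub_eq_add_neg]
  refine (X.newtonNorm_add_le hu hw.neg).trans ?_
  gcongr
  exact X.newtonNorm_neg_le hw

theorem newtonNorm_le_qnormENNReal_indicator (hw : IsUpperGradient h w) (hg : Measurable g)
    (hg_top : X.qnormENNReal g ≠ ∞) {K : ℝ≥0} (hhg : ∀ x, h x ≤ g x + K) {E : Set P}
    (hE : NullMeasurableSet E μ) (hwE : ∀ᵐ x ∂μ, x ∉ E → w x = 0) :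
    X.newtonNorm w ≤ X.qnorm w + X.modulus * X.qnormENNReal (E.indicator h) := by
  set N : Set P := {x | ¬(x ∉ E → w x = 0)}
  set F : Set P := toMeasurable μ E ∪ toMeasurable μ N
  have hFm : MeasurableSet F :=
    (measurableSet_toMeasurable _ _).union (measurableSet_toMeasurable _ _)
  have hFE : F =ᵐ[μ] E := (union_ae_eq_left_of_ae_eq_empty <| ae_eq_empty.2 <|
    (measure_toMeasurable N).trans (ae_iff.1 hwE)).trans hE.toMeasurable_ae_eq
  have hwF : ∀ x ∉ F, w x = 0 := fun x hx => by
    by_contra hne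
    refine hx (Or.inr (subset_toMeasurable μ N fun hxN => hne (hxN fun hxE => hx ?_)))
    exact Or.inl (subset_toMeasurable μ E hxE)
  have hbound : ∀ δ : ℝ≥0, δ ≠ 0 → X.newtonNorm w ≤ X.qnorm w +
      X.modulus * (X.qnormENNReal (E.indicator h) + δ * X.qnormENNReal g) := fun δ hδ => by
    refine (X.newtonNorm_le (hw.indicator_add hg hhg hFm hwF hδ)).trans ?_
    gcongr
    rw [← X.qnormENNReal_congr_ae (hw.1.indicator hFm).aemeasurable
      (indicator_ae_eq_of_ae_eq_set hFE), ← X.qnormENNReal_const_mul δ hg.aemeasurable]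
    exact X.qnormENNReal_add_le (hw.1.indicator hFm).aemeasurable (hg.const_mul _).aemeasurable
  have hcont : Continuous fun δ : ℝ≥0 => X.qnorm w +
      X.modulus * (X.qnormENNReal (E.indicator h) + δ * X.qnormENNReal g) :=
    continuous_const.add <| (ENNReal.continuous_const_mul ENNReal.coe_ne_top).comp <|
      continuous_const.add <| (ENNReal.continuous_mul_const hg_top).comp ENNReal.continuous_coe
  have hlim := (hcont.tendsto 0).mono_left (nhdsWithin_le_nhds (s := {0}ᶜ))
  simpa using ge_of_tendsto hlim (eventually_mem_nhdsWithin.mono hbound)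

end Newton

end QuasiBanachFunctionLattice

section Truncation

/-- Truncation of an extended real number to `[-k, k]`, as a real number. -/
noncomputable def truncate (k : ℝ) (a : EReal) : ℝ :=
  (max (-(k : EReal)) (min (k : EReal) a)).toReal

variable {k : ℝ}

theorem truncate_coe (x : ℝ) : truncate k x = max (-k) (min k x) := by
  rw [truncate, ← EReal.coe_neg, ← EReal.coe_strictMono.monotone.map_min,
    ← EReal.coe_strictMono.monotone.map_max, EReal.toReal_coe]

theorem truncate_top (hk : 0 ≤ k) : truncate k ⊤ = k := by
  rw [truncate, min_eq_left le_top, ← EReal.coe_neg, ← EReal.coe_strictMono.monotone.map_max,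
    EReal.toReal_coe, max_eq_right (neg_le_self hk)]

theorem truncate_bot : truncate k ⊥ = -k := by
  rw [truncate, min_eq_right bot_le, max_eq_left bot_le, ← EReal.coe_neg, EReal.toReal_coe]

theorem measurable_truncate : Measurable (truncate k) :=
  (measurable_const.max (measurable_const.min measurable_id)).ereal_toReal

theorem abs_truncate_le (hk : 0 ≤ k) (a : EReal) : |truncate k a| ≤ k := by
  induction a with
  | bot => rw [truncate_bot, abs_neg, abs_of_nonneg hk]
  | top => rw [truncate_top hk, abs_of_nonneg hk]
  | coe x =>
    rw [truncate_coe, abs_le]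
    exact ⟨le_max_left _ _, max_le (neg_le_self hk) (min_le_left _ _)⟩

theorem abs_truncate_le_abs (hk : 0 ≤ k) (a : EReal) : (truncate k a : EReal).abs ≤ a.abs := by
  induction a with
  | bot => simp
  | top => simp
  | coe x =>
    rw [truncate_coe, ereal_abs_coe, ereal_abs_coe, enorm_le_iff_norm_le]
    grind [Real.norm_eq_abs]

theorem abs_sub_truncate_le_abs (hk : 0 ≤ k) (a : EReal) :
    (a - (truncate k a : EReal)).abs ≤ a.abs := by
  induction a with
  | bot => simp
  | top => simp
  | coe x =>
    rw [truncate_coe, ereal_abs_coe_sub_coe, ereal_abs_coe, enorm_le_iff_norm_le]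
    grind [Real.norm_eq_abs]

theorem sub_truncate_eq_zero {a : EReal} (ha : a.abs ≤ ENNReal.ofReal k) (hk : 0 ≤ k) :
    a - (truncate k a : EReal) = 0 := by
  induction a with
  | bot => simp at ha
  | top => simp at ha
  | coe x =>
    rw [EReal.abs_def, ENNReal.ofReal_le_ofReal_iff hk, abs_le] at ha
    rw [truncate_coe, min_eq_right ha.2, max_eq_right ha.1, ← EReal.coe_sub, sub_self,
      EReal.coe_zero]

theorem abs_truncate_sub_truncate_le (a b : EReal) :
    ((truncate k a : EReal) - (truncate k b : EReal)).abs ≤ (a - b).abs := by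
  rcases ereal_abs_sub_eq_top_or_exists_coe a b with h | ⟨x, y, rfl, rfl⟩
  · exact h ▸ le_top
  · rw [truncate_coe, truncate_coe, ereal_abs_coe_sub_coe, ereal_abs_coe_sub_coe,
      enorm_le_iff_norm_le]
    grind [Real.norm_eq_abs]

theorem abs_sub_truncate_sub_sub_truncate_le (a b : EReal) :
    ((a - (truncate k a : EReal)) - (b - (truncate k b : EReal))).abs ≤ (a - b).abs := by
  rcases ereal_abs_sub_eq_top_or_exists_coe a b with h | ⟨x, y, rfl, rfl⟩
  · exact h ▸ le_top
  · rw [truncate_coe, truncate_coe, ← EReal.coe_sub, ← EReal.coe_sub, ereal_abs_coe_sub_coe,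
      ereal_abs_coe_sub_coe, enorm_le_iff_norm_le]
    grind [Real.norm_eq_abs]

theorem measurable_sub_truncate : Measurable fun a : EReal => a - (truncate k a : EReal) := by
  simp only [sub_eq_add_neg, ← EReal.coe_neg]
  exact measurable_id.add measurable_truncate.neg.coe_real_ereal

end Truncation

namespace QuasiBanachFunctionLattice

section Approximation

variable {P : Type*} [MetricSpace P] [MeasurableSpace P] {μ : Measure P}
  (X : QuasiBanachFunctionLattice μ) {u : P → EReal} {v : P → ℝ} {g : P → ℝ≥0∞}

theorem newtonNorm_truncate_le (hu : AEMeasurable u μ) {k : ℝ} (hk : 0 ≤ k) :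
    X.newtonNorm (fun x => (truncate k (u x) : EReal)) ≤ X.newtonNorm u :=
  add_le_add
    (X.qnorm_mono _ _ (measurable_truncate.comp_aemeasurable hu).coe_real_ereal hu <|
      Eventually.of_forall fun _ => abs_truncate_le_abs hk _)
    (le_iInf₂ fun g hg => iInf₂_le g <|
      hg.mono hg.1 le_rfl fun _ _ => abs_truncate_sub_truncate_le _ _)

theorem tendsto_newtonNorm_sub_truncate (hu : X.Mem u) (hg : IsUpperGradient g u)
    (hg_top : X.qnormENNReal g ≠ ∞) (hu_ac : X.HasAbsolutelyContinuousNorm u)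
    (hg_ac : X.HasAbsolutelyContinuousNorm fun x => (g x : EReal)) :
    Tendsto (fun n : ℕ => X.newtonNorm fun x => u x - (truncate n (u x) : EReal)) atTop (𝓝 0) := by
  have habs : AEMeasurable (fun x => (u x).abs) μ := measurable_ereal_abs.comp_aemeasurable hu.1
  set A : ℕ → Set P := fun n => {x | n < (u x).abs}
  have hA : ∀ n, NullMeasurableSet (A n) μ := fun n =>
    habs.nullMeasurableSet_preimage measurableSet_Ioi
  have hzero : ∀ n, ∀ x ∉ A n, u x - (truncate n (u x) : EReal) = 0 := fun n x hx =>
    sub_truncate_eq_zero (ENNReal.ofReal_natCast n ▸ not_lt.1 hx) n.cast_nonneg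
  have hbound : ∀ n : ℕ, X.newtonNorm (fun x => u x - (truncate n (u x) : EReal)) ≤
      X.qnorm ((A n).indicator u) +
        X.modulus * X.qnorm ((A n).indicator fun x => (g x : EReal)) := fun n => by
    have hw := hg.mono hg.1 le_rfl (w := fun x => u x - (truncate n (u x) : EReal))
      fun _ _ => abs_sub_truncate_sub_sub_truncate_le _ _
    rw [qnorm_indicator_coe_ennreal]
    refine (X.newtonNorm_le_qnormENNReal_indicator hw hg.1 hg_top (K := 0)
      (fun x => le_self_add) (hA n) (Eventually.of_forall (hzero n))).trans ?_
    gcongr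
    refine X.qnorm_mono _ _ (measurable_sub_truncate.comp_aemeasurable hu.1)
      (hu.1.indicator₀ (hA n)) (Eventually.of_forall fun x => ?_)
    by_cases hx : x ∈ A n
    · rw [Set.indicator_of_mem hx]
      exact abs_sub_truncate_le_abs n.cast_nonneg _
    · simp [hzero n x hx]
  have hu_top := X.ae_abs_ne_top_of_mem hu
  have hlim := (hu_ac.tendsto_qnorm_indicator_lt habs hu_top).add <| ENNReal.Tendsto.const_mul
    (hg_ac.tendsto_qnorm_indicator_lt habs hu_top) (.inr (ENNReal.coe_ne_top (r := X.modulus)))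
  exact tendsto_of_tendsto_of_tendsto_of_le_of_le tendsto_const_nhds (by simpa using hlim)
    (fun _ => zero_le) hbound

theorem exists_lipschitzWith_newtonNorm_sub_le [OpensMeasurableSpace P] (hv : AEMeasurable v μ)
    {k : ℝ≥0} (hk : ∀ x, |v x| ≤ k) (hg : IsUpperGradient g fun x => (v x : EReal))
    (hg_top : X.qnormENNReal g ≠ ∞) {L : ℝ≥0} {s E : Set P} (hvs : LipschitzOnWith L v s)
    (hE : NullMeasurableSet E μ) (hEs : ∀ᵐ x ∂μ, x ∉ E → x ∈ s) :
    ∃ f : P → ℝ, LipschitzWith L f ∧ X.newtonNorm (fun x => (v x : EReal) - (f x : EReal)) ≤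
      X.qnormENNReal (E.indicator fun _ => 2 * k) +
        X.modulus * X.qnormENNReal (E.indicator fun x => g x + L) := by
  obtain ⟨F, hF, hvF⟩ := hvs.extend_real
  set f : P → ℝ := fun x => max (-k) (min k (F x))
  have hf : LipschitzWith L f := (hF.const_min k).const_max (-k)
  have hvf : ∀ x ∈ s, v x - f x = 0 := fun x hx => by
    have hvk := abs_le.1 (hk x)
    simp only [f, ← hvF hx, min_eq_right hvk.2, max_eq_right hvk.1, sub_self]
  have hvf_le : ∀ x, ‖v x - f x‖ₑ ≤ 2 * k := fun x => by
    have hfk : |f x| ≤ k :=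
      abs_le.2 ⟨le_max_left _ _, max_le (neg_le_self k.coe_nonneg) (min_le_left _ _)⟩
    refine (enorm_sub_le).trans (two_mul (k : ℝ≥0∞) ▸ add_le_add ?_ ?_)
    · exact enorm_le_coe.2 (hk x)
    · exact enorm_le_coe.2 hfk
  have hw : IsUpperGradient (fun x => g x + L) fun x => (v x : EReal) - (f x : EReal) := by
    simpa only [sub_eq_add_neg] using hg.add (IsUpperGradient.of_lipschitzWith hf).neg
  have hwE : ∀ᵐ x ∂μ, x ∉ E → (v x : EReal) - (f x : EReal) = 0 := by
    filter_upwards [hEs] with x hx hxE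
    rw [← EReal.coe_sub, hvf x (hx hxE), EReal.coe_zero]
  refine ⟨f, hf, (X.newtonNorm_le_qnormENNReal_indicator hw hg.1 hg_top (fun _ => le_rfl) hE
    hwE).trans (add_le_add_left ?_ _)⟩
  refine X.qnorm_le_qnormENNReal ?_ (aemeasurable_const.indicator₀ hE) ?_
  · simp only [← EReal.coe_sub]
    exact (hv.sub hf.continuous.aemeasurable).coe_real_ereal
  · filter_upwards [hwE] with x hx
    by_cases hxE : x ∈ E
    · simpa only [ereal_abs_coe_sub_coe, Set.indicator_of_mem hxE] using hvf_le x
    · simp [hx hxE]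

theorem exists_lipschitzWith_mul_newtonNorm_sub_le [BorelSpace P]
    (hμ : IsDoublingMetricMeasure μ) {p : ℝ} (hP : SupportsPoincare μ p) (hv : AEMeasurable v μ)
    {k : ℝ≥0} (hk : ∀ x, |v x| ≤ k) (hg : IsUpperGradient g fun x => (v x : EReal))
    (hg_top : X.qnormENNReal g ≠ ∞) :
    ∃ K : ℝ≥0, ∀ (σ : ℝ≥0) (E : Set P), 1 ≤ σ → NullMeasurableSet E μ →
      {x | σ < maximalFunction μ p (fun x => (g x : EReal)) x} ⊆ E →
      ∃ f : P → ℝ, LipschitzWith (K * σ) f ∧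
        X.newtonNorm (fun x => (v x : EReal) - (f x : EReal)) ≤
          (2 * k : ℝ≥0) * X.qnormENNReal (E.indicator fun _ => σ) +
            X.modulus * (X.modulus * (X.qnormENNReal (E.indicator g) +
              K * X.qnormENNReal (E.indicator fun _ => σ))) := by
  have := hμ.secondCountableTopology
  have := hμ.isUnifLocDoublingMeasure
  have := hμ.isLocallyFiniteMeasure
  have hv_int := hμ.isLocallyIntegrable_of_abs_le hv hk
  obtain ⟨K, hK⟩ := hP.exists_lipschitzOnWith hμ
  refine ⟨K, fun σ E hσ hE hσE => ?_⟩
  have hEs : ∀ᵐ x ∂μ, x ∉ E → x ∈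
      {x | IsLebesguePoint μ v x ∧ maximalFunction μ p (fun x => (g x : EReal)) x ≤ σ} := by
    filter_upwards [ae_isLebesguePoint hv_int.locallyIntegrable] with x hx hxE
    exact ⟨hx, not_lt.1 fun hxσ => hxE (hσE hxσ)⟩
  obtain ⟨f, hf, hvf⟩ :=
    X.exists_lipschitzWith_newtonNorm_sub_le hv hk hg hg_top (hK v g hv_int hg σ) hE hEs
  refine ⟨f, hf, hvf.trans ?_⟩
  have h2k : (2 * k : ℝ≥0∞) ≤ (2 * k : ℝ≥0) * σ := by
    exact_mod_cast le_mul_of_one_le_right (zero_le (a := 2 * k)) hσ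
  gcongr
  · rw [← X.qnormENNReal_indicator_const_mul hE]
    refine X.qnormENNReal_mono_ae (aemeasurable_const.indicator₀ hE)
      (aemeasurable_const.indicator₀ hE) (Eventually.of_forall fun x => ?_)
    exact Set.indicator_le_indicator h2k
  · simpa only [ENNReal.coe_mul] using X.qnormENNReal_indicator_add_mul_le hg.1.aemeasurable hE K σ

theorem exists_lipschitzWith_newtonNorm_sub_lt [BorelSpace P] (hμ : IsDoublingMetricMeasure μ)
    {p : ℝ} (hP : SupportsPoincare μ p) (hv : AEMeasurable v μ) {k : ℝ≥0} (hk : ∀ x, |v x| ≤ k)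
    (hg : IsUpperGradient g fun x => (v x : EReal)) (hg_top : X.qnormENNReal g ≠ ∞)
    (hg_ac : X.HasAbsolutelyContinuousNorm fun x => (g x : EReal))
    (hM : Tendsto (fun n : ℕ => X.qnormENNReal
      ({x | n < maximalFunction μ p (fun x => (g x : EReal)) x}.indicator fun _ => (n : ℝ≥0∞)))
      atTop (𝓝 0)) {ε : ℝ≥0∞} (hε : 0 < ε) :
    ∃ f : P → ℝ, (∃ L : ℝ≥0, LipschitzWith L f) ∧
      X.newtonNorm (fun x => (v x : EReal) - (f x : EReal)) < ε := by
  obtain ⟨K, hK⟩ := X.exists_lipschitzWith_mul_newtonNorm_sub_le hμ hP hv hk hg hg_top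
  have hMg : AEMeasurable (maximalFunction μ p fun x => (g x : EReal)) μ :=
    (measurable_maximalFunction _).aemeasurable
  set E : ℕ → Set P := fun n => {x | n < maximalFunction μ p (fun x => (g x : EReal)) x}
  have hgE : Tendsto (fun n => X.qnormENNReal ((E n).indicator g)) atTop (𝓝 0) := by
    simpa only [qnorm_indicator_coe_ennreal] using hg_ac.tendsto_qnorm_indicator_lt hMg <|
      X.ae_ne_top_of_eventually_qnormENNReal_indicator_le hMg ENNReal.one_ne_top
        (hM.eventually_le_const one_pos)
  have hcont : Continuous fun y : ℝ≥0∞ × ℝ≥0∞ =>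
      (2 * k : ℝ≥0) * y.1 + X.modulus * (X.modulus * (y.2 + K * y.1)) := by
    fun_prop (disch := exact ENNReal.coe_ne_top)
  have hlim := (hcont.tendsto (0, 0)).comp (hM.prodMk_nhds hgE)
  simp only [add_zero, mul_zero] at hlim
  obtain ⟨n, hnε, hn⟩ := ((hlim.eventually_lt_const hε).and (eventually_ge_atTop 1)).exists
  obtain ⟨f, hf, hvf⟩ := hK n (E n) (Nat.one_le_cast.2 hn)
    (hMg.nullMeasurableSet_preimage measurableSet_Ioi) le_rfl
  exact ⟨f, ⟨_, hf⟩, hvf.trans_lt hnε⟩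

end Approximation

end QuasiBanachFunctionLattice

theorem memNewton_of_newtonNorm_sub_lt_top {P : Type*} [MetricSpace P] [MeasurableSpace P]
    {μ : Measure P} (X : QuasiBanachFunctionLattice μ) {v f : P → ℝ} (hf : AEMeasurable f μ)
    (hv : X.MemNewton fun x => (v x : EReal))
    (hvf : X.newtonNorm (fun x => (v x : EReal) - (f x : EReal)) < ∞) :
    X.MemNewton fun x => (f x : EReal) := by
  refine ⟨hf.coe_real_ereal, ?_⟩
  have hvm : AEMeasurable v μ := by simpa using hv.1.ereal_toReal
  have hvfm : AEMeasurable (fun x => (v x : EReal) - (f x : EReal)) μ := by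
    simp only [← EReal.coe_sub]
    exact (hvm.sub hf).coe_real_ereal
  have hle := X.newtonNorm_sub_le hv.1 hvfm
  simp only [← EReal.coe_sub, sub_sub_cancel] at hle hvf
  exact hle.trans_lt (ENNReal.mul_lt_top ENNReal.coe_lt_top (ENNReal.add_lt_top.2 ⟨hv.2, hvf⟩))

theorem mainTheorem1_general {P : Type*} [MetricSpace P] [MeasurableSpace P] [BorelSpace P]
    (μ : Measure P) (hμ : IsDoublingMetricMeasure μ)
    (p : ℝ) (_hp : p ≠ 0) (hP : SupportsPoincare μ p)
    (X : QuasiBanachFunctionLattice μ) {u : P → EReal} (hu : X.Mem u) {g : P → ℝ≥0∞}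
    (hg : IsUpperGradient g u) (hg_top : X.qnormENNReal g ≠ ∞)
    (hu_ac : X.HasAbsolutelyContinuousNorm u)
    (hg_ac : X.HasAbsolutelyContinuousNorm fun x => (g x : EReal))
    (hM : Tendsto (fun n : ℕ => X.qnormENNReal
      ({x | n < maximalFunction μ p (fun x => (g x : EReal)) x}.indicator fun _ => (n : ℝ≥0∞)))
      atTop (𝓝 0))
    {ε : ℝ≥0∞} (hε : 0 < ε) :
    ∃ f : P → ℝ, (∃ K : ℝ≥0, LipschitzWith K f) ∧
      X.MemNewton (fun x => (f x : EReal)) ∧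
      X.newtonNorm (fun x => u x - (f x : EReal)) < ε := by
  obtain ⟨η, hη, hηε⟩ := ENNReal.exists_nnreal_pos_mul_lt
    (a := X.modulus * 2) (by finiteness) hε.ne'
  replace hη := ENNReal.coe_pos.2 hη
  obtain ⟨n, hn⟩ := ((X.tendsto_newtonNorm_sub_truncate hu hg hg_top hu_ac
    hg_ac).eventually_lt_const hη).exists
  set v : P → ℝ := fun x => truncate n (u x)
  have hv : AEMeasurable v μ := measurable_truncate.comp_aemeasurable hu.1
  have hgv : IsUpperGradient g fun x => (v x : EReal) :=
    hg.mono hg.1 le_rfl fun _ _ => abs_truncate_sub_truncate_le _ _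
  have hvN : X.newtonNorm (fun x => (v x : EReal)) < ∞ :=
    (X.newtonNorm_truncate_le hu.1 n.cast_nonneg).trans_lt <|
      (X.newtonNorm_le hg).trans_lt (ENNReal.add_lt_top.2 ⟨hu.2, hg_top.lt_top⟩)
  obtain ⟨f, ⟨K, hf⟩, hvf⟩ := X.exists_lipschitzWith_newtonNorm_sub_lt hμ hP (k := n) hv
    (fun x => abs_truncate_le n.cast_nonneg (u x)) hgv hg_top hg_ac hM hη
  have hfm : AEMeasurable f μ := hf.continuous.aemeasurable
  refine ⟨f, ⟨K, hf⟩, memNewton_of_newtonNorm_sub_lt_top X hfm ⟨hv.coe_real_ereal, hvN⟩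
    (hvf.trans ENNReal.coe_lt_top), ?_⟩
  have hvfm : AEMeasurable (fun x => (v x : EReal) - (f x : EReal)) μ := by
    simp only [← EReal.coe_sub]
    exact (hv.sub hfm).coe_real_ereal
  calc X.newtonNorm (fun x => u x - (f x : EReal))
      = X.newtonNorm (fun x => u x - (v x : EReal) + ((v x : EReal) - (f x : EReal))) := by
        simp only [ereal_sub_coe_add_coe_sub_coe]
    _ ≤ X.modulus * (η + η) :=
        (X.newtonNorm_add_le (measurable_sub_truncate.comp_aemeasurable hu.1) hvfm).trans
          (mul_le_mul_right (add_le_add hn.le hvf.le) _)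
    _ = η * (X.modulus * 2) := by ring
    _ < ε := hηε

theorem mainTheorem1 {P : Type*} [MetricSpace P] [MeasurableSpace P] [BorelSpace P]
    (μ : Measure P) (hμ : IsDoublingMetricMeasure μ)
    (p : ℝ) (hp : 1 ≤ p) (hP : SupportsPoincare μ p)
    (X : QuasiBanachFunctionLattice μ) (hX : X.AbsolutelyContinuous)
    (hM : ∀ v : P → EReal, X.Mem v →
      Tendsto (fun σ : ℝ => X.qnorm
        ({x | ENNReal.ofReal σ < maximalFunction μ p v x}.indicator (fun _ => (σ : EReal))))
        atTop (𝓝 0)) :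
    ∀ u : P → EReal, X.MemNewton u → ∀ ε : ℝ≥0∞, 0 < ε →
      ∃ f : P → ℝ, (∃ K : ℝ≥0, LipschitzWith K f) ∧
        X.MemNewton (fun x => (f x : EReal)) ∧
        X.newtonNorm (fun x => u x - (f x : EReal)) < ε := by
  intro u hu ε hε
  obtain ⟨g, hg, hug⟩ := X.newtonNorm_lt_iff.1 hu.2
  have huX : X.Mem u := ⟨hu.1, le_self_add.trans_lt hug⟩
  have hgX : X.Mem fun x => (g x : EReal) :=
    ⟨hg.1.aemeasurable.coe_ereal_ennreal, le_add_self.trans_lt hug⟩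
  refine mainTheorem1_general μ hμ p (zero_lt_one.trans_le hp).ne' hP X huX hg hgX.2.ne (hX u huX)
    (hX _ hgX) ?_ hε
  simpa [Function.comp_def, ereal_coe_ennreal_natCast, ← X.qnorm_indicator_coe_ennreal] using
    (hM _ hgX).comp tendsto_natCast_atTop_atTop
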